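/- Let $d\in\mathbb{N}$ and let $\mathcal{G}=(\mathcal{G}(\mathbf{s}))_{\mathbf{s}\in\mathbb{R}^d}$ be a real-valued Gaussian process with mean function $\mu(\mathbf{s})=\mathbb{E}[\mathcal{G}(\mathbf{s})]$ and covariance kernel $\mathcal{C}(\mathbf{s},\mathbf{t})=\operatorname{Cov}(\mathcal{G}(\mathbf{s}),\mathcal{G}(\mathbf{t}))$. For $N\in\mathbb{N}$ let $\mu_N$ and $\mathcal{C}_N$ be the mean function and covariance kernel of the restriction of $\mathcal{G}$ to the cube $[-N,N]^d$, and let $\mathscr{H}_N$ be the reproducing kernel Hilbert space (RKHS) of $\mathcal{C}_N$, a space of real functions on $[-N,N]^d$. Assume: (i) with probability one, $\mathcal{G}$ has continuous sample paths and admits a maximizer over $\mathbb{R}^d$; (ii) for any $\mathbf{s},\mathbf{t}\in\mathbb{R}^d$ and any $\mathbf{h}\in\mathbb{R}^d\setminus\{\mathbf{0}\}$, $\mathcal{C}(\mathbf{h},\mathbf{h})>0$ and $$\mathcal{C}(\mathbf{h}+\mathbf{s},\mathbf{h}+\mathbf{t})-\mathcal{C}(\mathbf{h}+\mathbf{s},\mathbf{h})-\mathcal{C}(\mathbf{h},\mathbf{h}+\mathbf{t})+\mathcal{C}(\mathbf{h},\mathbf{h})=\mathcal{C}(\mathbf{s},\mathbf{t});$$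 (iii) for any $N\in\mathbb{N}$, $\mu_N\in\mathscr{H}_N$. Then with probability one $\mathcal{G}$ has exactly one maximizer over $\mathbb{R}^d$, so that $\hat{\mathbf{s}}=\operatorname{argmax}_{\mathbf{s}\in\mathbb{R}^d}\mathcal{G}(\mathbf{s})$ is well defined up to null sets; moreover $\hat{\mathbf{s}}$ is measurable up to null sets, and its distribution function $F_{\hat{\mathbf{s}}}(\mathbf{t})=\mathbb{P}[\hat{\mathbf{s}}\le\mathbf{t}]$, $\mathbf{t}\in\mathbb{R}^d$ (with $\le$ understood componentwise), is continuous on $\mathbb{R}^d$. -/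

import Mathlib

open MeasureTheory ProbabilityTheory

namespace GaussianArgmax

/-- The mean function `t ↦ E[X t]` of a real-valued stochastic process. -/
noncomputable def meanFun {Ω T : Type*} [MeasurableSpace Ω] (X : T → Ω → ℝ) (P : Measure Ω) :
    T → ℝ :=
  fun t ↦ ∫ ω, X t ω ∂P

/-- The covariance kernel `(s, t) ↦ Cov(X s, X t)` of a real-valued stochastic process. -/
noncomputable def covKernel {Ω T : Type*} [MeasurableSpace Ω] (X : T → Ω → ℝ) (P : Measure Ω) :
    T → T → ℝ :=
  fun s t ↦ cov[X s, X t; P]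

/-- A scalar kernel `K : T → T → ℝ`, written in the form that Mathlib's theory of (vector-valued)
reproducing kernel Hilbert spaces uses: the number `K s t` becomes the operator `x ↦ K s t * x`
on `ℝ`. -/
noncomputable def kernelMatrix {T : Type*} (K : T → T → ℝ) : Matrix T T (ℝ →L[ℝ] ℝ) :=
  Matrix.of fun s t ↦ K s t • ContinuousLinearMap.id ℝ ℝ

/-- The covariance kernel of a Gaussian process is positive semidefinite. -/
theorem posSemidef_covKernel {Ω T : Type*} [MeasurableSpace Ω] {X : T → Ω → ℝ} {P : Measure Ω}
    (hX : IsGaussianProcess X P) : (kernelMatrix (covKernel X P)).PosSemidef := by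
  have := hX.isProbabilityMeasure
  have hL : ∀ t, MemLp (X t) 2 P := fun t ↦ (hX.hasGaussianLaw_eval t).memLp_two
  apply ((RKHS.posSemidef_tfae (K := kernelMatrix (covKernel X P))).out 0 2).mpr
  refine ⟨?_, fun v ↦ ?_⟩
  · ext s t
    have h1 : star (ContinuousLinearMap.id ℝ ℝ) = ContinuousLinearMap.id ℝ ℝ :=
      ContinuousLinearMap.adjoint_id
    simp [kernelMatrix, Matrix.conjTranspose_apply, covKernel, covariance_comm (X s), h1]
  · have h : (v.sum fun x w ↦ v.sum fun x' w' ↦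
        inner ℝ ((kernelMatrix (covKernel X P)) x' x w) w') =
        cov[fun ω ↦ ∑ i ∈ v.support, v i * X i ω, fun ω ↦ ∑ i ∈ v.support, v i * X i ω; P] := by
      rw [covariance_fun_sum_fun_sum' (fun i _ ↦ (hL i).const_mul _)
        (fun i _ ↦ (hL i).const_mul _)]
      simp only [Finsupp.sum, kernelMatrix, covKernel, Matrix.of_apply,
        covariance_const_mul_left, covariance_const_mul_right]
      refine Finset.sum_congr rfl fun i _ ↦ Finset.sum_congr rfl fun j _ ↦ ?_
      rw [covariance_comm (X j)]
      simp only [_root_.smul_apply, ContinuousLinearMap.id_apply, smul_eq_mul,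
        RCLike.inner_apply, conj_trivial]
      ring
    rw [h]
    have hm : AEMeasurable (fun ω ↦ ∑ i ∈ v.support, v i * X i ω) P :=
      Finset.aemeasurable_fun_sum _ fun i _ ↦ (hX.aemeasurable i).const_mul _
    rw [covariance_self hm]
    simp [variance_nonneg]

/-- The reproducing kernel Hilbert space of the covariance kernel of a Gaussian process `X` indexed
by `T`, as a set of real functions on `T`: the functions that correspond to elements of the
completion of the pre-Hilbert space spanned by the kernel sections
(Mathlib's `RKHS.OfKernel`). -/
def covRKHS {Ω T : Type*} [MeasurableSpace Ω] {X : T → Ω → ℝ} {P : Measure Ω}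
    (hX : IsGaussianProcess X P) : Set (T → ℝ) :=
  haveI : Fact (kernelMatrix (covKernel X P)).PosSemidef := ⟨posSemidef_covKernel hX⟩
  Set.range fun (f : RKHS.OfKernel (kernelMatrix (covKernel X P))) ↦ (f : T → ℝ)

/-- The cube `[-N, N]^d` in `ℝ^d`. -/
def cube (d N : ℕ) : Set (Fin d → ℝ) :=
  Set.Icc (fun _ ↦ -(N : ℝ)) (fun _ ↦ (N : ℝ))

/-- `s` is a maximizer of `g` over the whole space. -/
def IsMaximizer {T : Type*} (g : T → ℝ) (s : T) : Prop :=
  ∀ t, g t ≤ g s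

end GaussianArgmax

/-!
The process is first replaced by an indistinguishable one with measurable values and continuous
paths. One device then serves twice: for jointly Gaussian `X` and `Z` with `Var Z ≠ 0`, the
residuals `R t = X t - h t * Z`, `h t = Cov(X t, Z) / Var Z`, form a process independent of `Z`
(`indepFun_sub_regression`), so conditionally on `R` only the number `Z` is random.

*Uniqueness.* The shift identity of the covariance makes all increments non-degenerate. For `s ≠ t` take
`Z = X s - X t`; then `h s = h t + 1` and `h` is continuous, so on suitable neighbourhoods `U` of `s`
and `V` of `t` the slopes on `U` exceed those on `V` by a margin. For fixed `R`, the suprema of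
`R + h * Z` over `U` and over `V` agree for at most one value of `Z`, and `Z` has no atoms. Countably
many pairs `U`, `V` cover all pairs of distinct points (`ae_maximizer_unique`).

*Removing the mean.* A function `μ` in the reproducing kernel Hilbert space is `t ↦ Cov(X t, Z)` for
some `Z` in the closed linear span of the centred process (`exists_of_mem_covRKHS`), and `Z` is
jointly Gaussian with the process since Gaussian laws are closed under `L²` limits. Adding
`Cov(W t, Z)` to `W t = R t + h t * Z` amounts to replacing `Z` by `Z + Var Z`, and the laws of these
two variables are equivalent. This gives the part of the Cameron–Martin theorem that is needed:
the law of `W + μ` is absolutely continuous with respect to that of `W`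
(`map_add_covariance_absolutelyContinuous`).

*No atoms.* Let the centred process have its maximum over a large cube `Q` on the slice
`H = {x i = c}` of a smaller cube with probability `p`. Increments are stationary, so the same
probability belongs to each of infinitely many small translates of `(H, Q)` in direction `i`. For two
of them the events exclude each other up to a null set: both maximizers lie in the
intersection of the two cubes, hence would be two distinct maximizers over it. So `p = 0`
(`measure_max_in_subset_eq_zero`), and by absolute continuity the same holds with the mean put back.
Hence no coordinate of the maximizer has an atom, which makes its distribution function continuous.
-/

open MeasureTheory ProbabilityTheory

namespace GaussianArgmax
open Filter Topology
open scoped RealInnerProductSpace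

variable {Ω T : Type*} [MeasurableSpace Ω] {P : Measure Ω}

/-! ### Gaussian laws: linear combinations, determination by moments, limits in `L²` -/

theorem hasGaussianLaw_sum_mul {X : T → Ω → ℝ} (hX : IsGaussianProcess X P) (I : Finset T)
    (c : T → ℝ) : HasGaussianLaw (fun ω ↦ ∑ i ∈ I, c i * X i ω) P := by
  simpa using (hX.smul c).hasGaussianLaw_fun_sum (I := I)

theorem strongDual_restrict_eq_sum [DecidableEq T] (I : Finset T) (L : StrongDual ℝ (I → ℝ))
    (x : T → ℝ) : L (I.restrict x) = ∑ i : I, L (Pi.single i 1) * x i := by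
  conv_lhs => rw [← Finset.univ_sum_single (I.restrict x), map_sum]
  refine Finset.sum_congr rfl fun i _ ↦ ?_
  have : (Pi.single i (I.restrict x i) : I → ℝ) = (x i) • (Pi.single i 1 : I → ℝ) := by
    rw [← Pi.single_smul]; simp
  rw [this, map_smul, smul_eq_mul, mul_comm]

/-- Gaussianity of a process may be tested on finite linear combinations of its values. -/
theorem isGaussianProcess_of_sum {X : T → Ω → ℝ} (hm : ∀ t, AEMeasurable (X t) P)
    (h : ∀ (I : Finset T) (c : T → ℝ), HasGaussianLaw (fun ω ↦ ∑ i ∈ I, c i * X i ω) P) :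
    IsGaussianProcess X P := by
  classical
  refine ⟨fun I ↦ ⟨isGaussian_of_isGaussian_map fun L ↦ ?_⟩⟩
  have hI : AEMeasurable (fun ω ↦ I.restrict (X · ω)) P :=
    aemeasurable_pi_lambda _ fun i ↦ hm i
  rw [AEMeasurable.map_map_of_aemeasurable (by fun_prop) hI]
  have key := (h I fun t ↦ if ht : t ∈ I then L (Pi.single ⟨t, ht⟩ 1) else 0).isGaussian_map
  convert! key using 2
  ext ω
  rw [← Finset.sum_coe_sort I, Function.comp_apply, strongDual_restrict_eq_sum]
  simp

theorem isGaussianProcess_sub_const [IsProbabilityMeasure P] {X : T → Ω → ℝ}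
    (hX : IsGaussianProcess X P) (m : T → ℝ) : IsGaussianProcess (fun t ω ↦ X t ω - m t) P := by
  refine isGaussianProcess_of_sum (fun t ↦ (hX.aemeasurable t).sub_const _) fun I c ↦ ?_
  have h1 := hasGaussianLaw_sum_mul hX I c
  have h2 : (fun ω ↦ ∑ i ∈ I, c i * (X i ω - m i)) =
      (fun x ↦ x + -∑ i ∈ I, c i * m i) ∘ fun ω ↦ ∑ i ∈ I, c i * X i ω := by
    ext ω
    simp only [mul_sub, Finset.sum_sub_distrib, Function.comp_apply]
    ring
  rw [h2]
  constructor
  rw [← AEMeasurable.map_map_of_aemeasurable (by fun_prop) h1.aemeasurable,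
    h1.map_eq_gaussianReal, gaussianReal_map_add_const]
  infer_instance

/-- The law of a Gaussian process, as a measure on the product space, is determined by its mean
function and covariance kernel. -/
theorem map_eq_of_mean_eq_of_covariance_eq [IsProbabilityMeasure P] {X Y : T → Ω → ℝ}
    (hX : IsGaussianProcess X P) (hY : IsGaussianProcess Y P)
    (hXm : ∀ t, Measurable (X t)) (hYm : ∀ t, Measurable (Y t))
    (hmean : ∀ t, ∫ ω, X t ω ∂P = ∫ ω, Y t ω ∂P)
    (hcov : ∀ s t, cov[X s, X t; P] = cov[Y s, Y t; P]) :
    P.map (fun ω t ↦ X t ω) = P.map (fun ω t ↦ Y t ω) := by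
  classical
  rw [map_eq_iff_forall_finset_map_restrict_eq (measurable_pi_lambda _ hXm).aemeasurable
    (measurable_pi_lambda _ hYm).aemeasurable]
  intro I
  have hX' := hX.hasGaussianLaw I
  have hY' := hY.hasGaussianLaw I
  have := hX'.isGaussian_map
  have := hY'.isGaussian_map
  apply Measure.ext_of_charFunDual
  ext L
  have hL : ∀ Z : T → Ω → ℝ, (fun ω ↦ L (I.restrict (Z · ω))) =
      fun ω ↦ ∑ i : I, L (Pi.single i 1) * Z i ω := fun Z ↦
    funext fun ω ↦ strongDual_restrict_eq_sum I L _
  have hvar : ∀ Z : T → Ω → ℝ, IsGaussianProcess Z P →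
      Var[fun ω ↦ ∑ i : I, L (Pi.single i 1) * Z i ω; P] =
        ∑ i : I, ∑ j : I, L (Pi.single i 1) * (L (Pi.single j 1) * cov[Z i, Z j; P]) := by
    intro Z hZ
    have hL2 : ∀ t, MemLp (Z t) 2 P := fun t ↦ (hZ.hasGaussianLaw_eval t).memLp_two
    have hL2' : ∀ i : I, MemLp (fun ω ↦ L (Pi.single i 1) * Z i ω) 2 P :=
      fun i ↦ (hL2 i).const_mul _
    rw [← covariance_self (Finset.aemeasurable_fun_sum
      (f := fun (i : I) ω ↦ L (Pi.single i 1) * Z i ω) _ fun i _ ↦ (hL2' i).aemeasurable), covariance_fun_sum_fun_sum hL2' hL2']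
    simp only [covariance_const_mul_left, covariance_const_mul_right]
    refine Finset.sum_congr rfl fun i _ ↦ Finset.sum_congr rfl fun j _ ↦ ?_
    ring
  have hint : ∀ Z : T → Ω → ℝ, IsGaussianProcess Z P →
      ∫ ω, ∑ i : I, L (Pi.single i 1) * Z i ω ∂P = ∑ i : I, L (Pi.single i 1) * ∫ ω, Z i ω ∂P := by
    intro Z hZ
    rw [integral_finsetSum (f := fun (i : I) ω ↦ L (Pi.single i 1) * Z i ω) _
      fun i _ ↦ (hZ.hasGaussianLaw_eval i).integrable.const_mul _]
    simp only [integral_const_mul]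
  rw [hX'.charFunDual_map_eq_fun, hY'.charFunDual_map_eq_fun, hL X, hL Y, hvar X hX, hvar Y hY,
    hint X hX, hint Y hY]
  simp only [hmean, hcov]

theorem integral_eq_inner_one [IsProbabilityMeasure P] (f : Lp ℝ 2 P) :
    ∫ ω, f ω ∂P = ⟪(memLp_const (1 : ℝ)).toLp (fun _ ↦ 1), f⟫ := by
  rw [L2.inner_def]
  refine integral_congr_ae ?_
  filter_upwards [(memLp_const (1 : ℝ) (μ := P) (p := 2)).coeFn_toLp] with ω hω
  rw [hω]; simp

theorem continuous_integral_Lp_two [IsProbabilityMeasure P] :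
    Continuous fun f : Lp ℝ 2 P ↦ ∫ ω, f ω ∂P := by
  simp only [integral_eq_inner_one]
  fun_prop

theorem continuous_variance_Lp_two [IsProbabilityMeasure P] :
    Continuous fun f : Lp ℝ 2 P ↦ Var[f; P] := by
  have h1 : ∀ f : Lp ℝ 2 P, Var[f; P] = ‖f‖ ^ 2 - (∫ ω, f ω ∂P) ^ 2 := by
    intro f
    rw [variance_eq_sub (Lp.memLp f), ← real_inner_self_eq_norm_sq, L2.inner_def]
    congr 1
    refine integral_congr_ae (ae_of_all _ fun ω ↦ ?_)
    simp [sq]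
  simp only [h1]
  exact (continuous_norm.pow 2).sub (continuous_integral_Lp_two.pow 2)

theorem charFun_map_eq_integral {X : Ω → ℝ} (hX : AEMeasurable X P) (t : ℝ) :
    charFun (P.map X) t = ∫ ω, Complex.exp (t * X ω * Complex.I) ∂P := by
  rw [charFun_apply_real, integral_map hX (by fun_prop)]

/-- The characteristic function of a random variable depends continuously on the variable, for
almost sure convergence. -/
theorem tendsto_charFun_of_ae_tendsto [IsProbabilityMeasure P] {ι : Type*} {l : Filter ι}
    [l.IsCountablyGenerated] {X : ι → Ω → ℝ} {Y : Ω → ℝ}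
    (hX : ∀ n, AEMeasurable (X n) P) (hY : AEMeasurable Y P)
    (h : ∀ᵐ ω ∂P, Tendsto (fun n ↦ X n ω) l (𝓝 (Y ω))) (t : ℝ) :
    Tendsto (fun n ↦ charFun (P.map (X n)) t) l (𝓝 (charFun (P.map Y) t)) := by
  simp only [charFun_map_eq_integral (hX _), charFun_map_eq_integral hY]
  refine tendsto_integral_filter_of_dominated_convergence (fun _ ↦ 1) (.of_forall fun n ↦ ?_)
    (.of_forall fun n ↦ ae_of_all _ fun ω ↦ ?_) (integrable_const _) ?_
  · have := hX n
    exact (by fun_prop : AEMeasurable _ P).aestronglyMeasurable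
  · rw [← Complex.ofReal_mul, Complex.norm_exp_ofReal_mul_I]
  · filter_upwards [h] with ω hω
    have hc : Continuous fun x : ℝ ↦ Complex.exp (t * x * Complex.I) := by fun_prop
    exact (hc.tendsto _).comp hω

theorem charFun_map_eq_of_hasGaussianLaw {X : Ω → ℝ} (hX : HasGaussianLaw X P) (t : ℝ) :
    charFun (P.map X) t = Complex.exp (((t * ∫ ω, X ω ∂P : ℝ) : ℂ) * Complex.I
        - ((t ^ 2 * Var[X; P] : ℝ) : ℂ) / 2) := by
  have hin : (fun ω ↦ ⟪t, X ω⟫) = fun ω ↦ t * X ω := by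
    ext ω; simp [mul_comm]
  rw [hX.charFun_map_eq t, hin, integral_const_mul, variance_const_mul]

theorem hasGaussianLaw_of_tendsto [IsProbabilityMeasure P] {X : ℕ → Ω → ℝ} {Y : Ω → ℝ}
    (hX : ∀ n, HasGaussianLaw (X n) P) (hY : AEMeasurable Y P)
    (h : ∀ᵐ ω ∂P, Tendsto (fun n ↦ X n ω) atTop (𝓝 (Y ω)))
    (hmean : Tendsto (fun n ↦ ∫ ω, X n ω ∂P) atTop (𝓝 (∫ ω, Y ω ∂P)))
    (hvar : Tendsto (fun n ↦ Var[X n; P]) atTop (𝓝 Var[Y; P])) : HasGaussianLaw Y P := by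
  rw [hasGaussianLaw_iff_charFun_map_eq hY]
  intro t
  refine tendsto_nhds_unique
    (tendsto_charFun_of_ae_tendsto (fun n ↦ (hX n).aemeasurable) hY h t) ?_
  have hin : (fun ω ↦ ⟪t, Y ω⟫) = fun ω ↦ t * Y ω := by
    ext ω; simp [mul_comm]
  rw [hin, integral_const_mul, variance_const_mul]
  simp only [charFun_map_eq_of_hasGaussianLaw (hX _)]
  have hc : Continuous fun p : ℝ × ℝ ↦
      Complex.exp ((p.1 : ℂ) * Complex.I - (p.2 : ℂ) / 2) := by fun_prop
  have h3 := (hc.tendsto (t * ∫ ω, Y ω ∂P, t ^ 2 * Var[Y; P])).comp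
    ((hmean.const_mul t).prodMk_nhds (hvar.const_mul (t ^ 2)))
  refine h3.congr fun n ↦ ?_
  simp only [Function.comp_apply]

/-- Gaussian laws are stable under `L²` limits. -/
theorem isClosed_setOf_hasGaussianLaw [IsProbabilityMeasure P] :
    IsClosed {f : Lp ℝ 2 P | HasGaussianLaw f P} := by
  refine IsSeqClosed.isClosed fun f g hf hfg ↦ ?_
  simp only [Set.mem_ofPred_eq] at hf ⊢
  obtain ⟨φ, hφ, hae⟩ := (tendstoInMeasure_of_tendsto_Lp hfg).exists_seq_tendsto_ae
  have hφ' : Tendsto (fun n ↦ f (φ n)) atTop (𝓝 g) := hfg.comp hφ.tendsto_atTop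
  exact hasGaussianLaw_of_tendsto (fun n ↦ hf (φ n)) (Lp.memLp g).aemeasurable hae
    ((continuous_integral_Lp_two.tendsto g).comp hφ')
    ((continuous_variance_Lp_two.tendsto g).comp hφ')

/-- Variables taken from one linear space of Gaussian variables are jointly Gaussian. -/
theorem isGaussianProcess_of_mem_submodule [IsProbabilityMeasure P] {X : T → Ω → ℝ}
    (hX : ∀ t, MemLp (X t) 2 P) (V : Submodule ℝ (Lp ℝ 2 P))
    (hV : ∀ f ∈ V, HasGaussianLaw f P) (hXV : ∀ t, (hX t).toLp (X t) ∈ V) :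
    IsGaussianProcess X P := by
  refine isGaussianProcess_of_sum (fun t ↦ (hX t).aemeasurable) fun I c ↦ ?_
  have h1 : ∑ i ∈ I, c i • (hX i).toLp (X i) ∈ V :=
    V.sum_mem fun i _ ↦ V.smul_mem _ (hXV i)
  refine (hV _ h1).congr ?_
  have h2 : ∀ᵐ ω ∂P, ∀ i ∈ I, (c i • (hX i).toLp (X i) : Lp ℝ 2 P) ω = c i * X i ω := by
    refine (ae_ball_iff I.countable_toSet).mpr fun i _ ↦ ?_
    filter_upwards [Lp.coeFn_smul (c i) ((hX i).toLp (X i)), (hX i).coeFn_toLp] with ω h h'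
    rw [h, Pi.smul_apply, h', smul_eq_mul]
  filter_upwards [h2, Lp.coeFn_finsetSum I fun i ↦ c i • (hX i).toLp (X i)] with ω h h'
  rw [h', Finset.sum_apply]
  exact Finset.sum_congr rfl h

theorem hasGaussianLaw_of_mem_closure_span [IsProbabilityMeasure P] {X : T → Ω → ℝ}
    (hX : IsGaussianProcess X P) (hL : ∀ t, MemLp (X t) 2 P) (f : Lp ℝ 2 P)
    (hf : f ∈ (Submodule.span ℝ (Set.range fun t ↦ (hL t).toLp (X t))).topologicalClosure) :
    HasGaussianLaw f P := by
  rw [← SetLike.mem_coe, Submodule.topologicalClosure_coe] at hf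
  refine closure_minimal (fun g hg ↦ ?_) isClosed_setOf_hasGaussianLaw hf
  obtain ⟨c, rfl⟩ := (Finsupp.mem_span_range_iff_exists_finsupp).mp hg
  refine (hasGaussianLaw_sum_mul hX c.support c).congr ?_
  have h2 : ∀ᵐ ω ∂P, ∀ i ∈ c.support, (c i • (hL i).toLp (X i) : Lp ℝ 2 P) ω = c i * X i ω := by
    refine (ae_ball_iff c.support.countable_toSet).mpr fun i _ ↦ ?_
    filter_upwards [Lp.coeFn_smul (c i) ((hL i).toLp (X i)), (hL i).coeFn_toLp] with ω h h'
    rw [h, Pi.smul_apply, h', smul_eq_mul]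
  filter_upwards [h2, Lp.coeFn_finsetSum c.support fun i ↦ c i • (hL i).toLp (X i)] with ω h h'
  rw [Finsupp.sum, h', Finset.sum_apply]
  exact (Finset.sum_congr rfl h).symm

/-! ### Regression on one variable and translation of Gaussian laws -/

theorem isGaussianProcess_linear_pair {S : Type*} {X : T → Ω → ℝ} (hX : IsGaussianProcess X P)
    (a b : S → ℝ) (f g : S → T) :
    IsGaussianProcess (fun s ω ↦ a s * X (f s) ω + b s * X (g s) ω) P := by
  classical
  refine hX.of_isGaussianProcess fun s ↦ ⟨{f s, g s},
    a s • ContinuousLinearMap.proj (⟨f s, by simp⟩ : ({f s, g s} : Finset T)) +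
    b s • ContinuousLinearMap.proj (⟨g s, by simp⟩ : ({f s, g s} : Finset T)), fun ω ↦ ?_⟩
  simp

/-- The residuals of a Gaussian process after linear regression on a variable `Z` that is jointly
Gaussian with it are, as a process, independent of `Z`. -/
theorem indepFun_sub_regression {X : T → Ω → ℝ} {Z : Ω → ℝ}
    (h : IsGaussianProcess (Sum.elim X fun _ : Unit ↦ Z) P) (hv : Var[Z; P] ≠ 0) :
    IndepFun Z (fun ω t ↦ X t ω - cov[X t, Z; P] / Var[Z; P] * Z ω) P := by
  have := h.isProbabilityMeasure
  have hZ : HasGaussianLaw Z P := h.hasGaussianLaw_eval (.inr ())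
  have hX : ∀ t, HasGaussianLaw (X t) P := fun t ↦ h.hasGaussianLaw_eval (.inl t)
  have h1 : IsGaussianProcess (Sum.elim (fun _ : Unit ↦ Z)
      fun t ω ↦ X t ω - cov[X t, Z; P] / Var[Z; P] * Z ω) P := by
    convert! isGaussianProcess_linear_pair h (S := Unit ⊕ T) (fun _ ↦ 1)
      (Sum.elim (fun _ ↦ 0) fun t ↦ -(cov[X t, Z; P] / Var[Z; P]))
      (Sum.elim (fun _ ↦ .inr ()) .inl) (fun _ ↦ .inr ()) with s ω
    rcases s with s | s <;> simp [sub_eq_add_neg]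
  have h2 := h1.indepFun_of_covariance_eq_zero (fun _ ↦ hZ.aemeasurable)
    (fun t ↦ (hX t).aemeasurable.sub (hZ.aemeasurable.const_mul _)) fun _ t ↦ by
      rw [covariance_fun_sub_right hZ.memLp_two (hX t).memLp_two (hZ.memLp_two.const_mul _),
        covariance_const_mul_right, covariance_self hZ.aemeasurable, covariance_comm Z]
      field_simp
      simp
  exact h2.comp (φ := fun x : Unit → ℝ ↦ x ()) (ψ := id) (measurable_pi_apply _) measurable_id

theorem covariance_eq_zero_of_variance_eq_zero {X Z : Ω → ℝ} [IsProbabilityMeasure P]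
    (hZ : MemLp Z 2 P) (hv : Var[Z; P] = 0) : cov[X, Z; P] = 0 := by
  have h1 : Z =ᵐ[P] fun _ ↦ P[Z] := by
    rw [← evariance_eq_zero_iff hZ.aemeasurable, ← hZ.ofReal_variance_eq, hv, ENNReal.ofReal_zero]
  rw [covariance]
  refine integral_eq_zero_of_ae ?_
  filter_upwards [h1] with ω hω
  simp [hω]

/-- The part of the Cameron–Martin theorem used here: adding `t ↦ Cov(W t, Z)` to a Gaussian
process `W` gives a law absolutely continuous with respect to the law of `W`. No mean is assumed
to vanish. -/
theorem map_add_covariance_absolutelyContinuous {W : T → Ω → ℝ} {Z : Ω → ℝ}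
    (hW : ∀ t, Measurable (W t)) (hZm : Measurable Z)
    (h : IsGaussianProcess (Sum.elim W fun _ : Unit ↦ Z) P) :
    P.map (fun ω t ↦ W t ω + cov[W t, Z; P]) ≪ P.map (fun ω t ↦ W t ω) := by
  have := h.isProbabilityMeasure
  have hZ : HasGaussianLaw Z P := h.hasGaussianLaw_eval (.inr ())
  by_cases hv : Var[Z; P] = 0
  · simp only [covariance_eq_zero_of_variance_eq_zero hZ.memLp_two hv, add_zero]
    exact Measure.AbsolutelyContinuous.rfl
  have hv' : Var[Z; P].toNNReal ≠ 0 := by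
    simpa using lt_of_le_of_ne (variance_nonneg Z P) (Ne.symm hv)
  set R : Ω → T → ℝ := fun ω t ↦ W t ω - cov[W t, Z; P] / Var[Z; P] * Z ω with hR
  have hRm : Measurable R := measurable_pi_lambda _ fun t ↦ (hW t).sub (hZm.const_mul _)
  have hind : IndepFun Z R P := indepFun_sub_regression h hv
  set Φ : ℝ × (T → ℝ) → T → ℝ := fun p t ↦ p.2 t + cov[W t, Z; P] / Var[Z; P] * p.1 with hΦ
  have hΦm : Measurable Φ := measurable_pi_lambda _ fun t ↦
    ((measurable_pi_apply t).comp measurable_snd).add (measurable_fst.const_mul _)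
  have e1 : (fun ω t ↦ W t ω + cov[W t, Z; P]) = Φ ∘ fun ω ↦ (Z ω + Var[Z; P], R ω) := by
    ext ω t
    simp only [hΦ, hR, Function.comp_apply]
    field_simp
    ring
  have e2 : (fun ω t ↦ W t ω) = Φ ∘ fun ω ↦ (Z ω, R ω) := by
    ext ω t
    simp only [hΦ, hR, Function.comp_apply]
    ring
  have hind' : IndepFun (fun ω ↦ Z ω + Var[Z; P]) R P :=
    hind.comp (φ := fun x ↦ x + Var[Z; P]) (ψ := id) (by fun_prop) measurable_id
  -- both laws are images under `Φ` of product measures that differ only in the first factor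
  rw [e1, e2, ← Measure.map_map hΦm (by fun_prop), ← Measure.map_map hΦm (by fun_prop),
    hind.map_prod_eq_prod_map_map (by fun_prop) (by fun_prop),
    hind'.map_prod_eq_prod_map_map (by fun_prop) (by fun_prop)]
  refine Measure.AbsolutelyContinuous.map (.prod ?_ .rfl) hΦm
  have e3 : (fun ω ↦ Z ω + Var[Z; P]) = (fun x ↦ x + Var[Z; P]) ∘ Z := rfl
  rw [e3, ← Measure.map_map (by fun_prop) hZm, hZ.map_eq_gaussianReal, gaussianReal_map_add_const]
  exact (gaussianReal_absolutelyContinuous _ hv').trans (gaussianReal_absolutelyContinuous' _ hv')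

/-! ### Elements of the reproducing kernel Hilbert space as covariances -/

/-- Two families of vectors with the same Gram matrix have isometric closed spans: each vector `f` of
the closed span of `u` has a counterpart `z` in that of `w`. -/
theorem exists_mem_closure_span_inner_eq {H H' : Type*} [NormedAddCommGroup H]
    [InnerProductSpace ℝ H] [NormedAddCommGroup H'] [InnerProductSpace ℝ H'] [CompleteSpace H']
    {u : T → H} {w : T → H'} (h : ∀ s t, ⟪u s, u t⟫ = ⟪w s, w t⟫) {f : H}
    (hf : f ∈ (Submodule.span ℝ (Set.range u)).topologicalClosure) :
    ∃ z ∈ (Submodule.span ℝ (Set.range w)).topologicalClosure, ∀ t, ⟪w t, z⟫ = ⟪u t, f⟫ := by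
  set A := Finsupp.linearCombination ℝ u
  set B := Finsupp.linearCombination ℝ w
  have hAB : ∀ t c, ⟪w t, B c⟫ = ⟪u t, A c⟫ := fun t c ↦ by
    simp [A, B, Finsupp.linearCombination_apply, Finsupp.inner_sum, inner_smul_right, h]
  have hAB' : ∀ c c', ⟪B c, B c'⟫ = ⟪A c, A c'⟫ := fun c c' ↦ by
    conv_lhs => rw [Finsupp.linearCombination_apply, Finsupp.sum_inner]
    conv_rhs => rw [Finsupp.linearCombination_apply, Finsupp.sum_inner]
    simp [inner_smul_left, hAB]
  have hnorm : ∀ c, ‖B c‖ = ‖A c‖ := fun c ↦ by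
    rw [norm_eq_sqrt_real_inner, norm_eq_sqrt_real_inner, hAB']
  rw [← SetLike.mem_coe, Submodule.topologicalClosure_coe, mem_closure_iff_seq_limit] at hf
  obtain ⟨x, hx, hxf⟩ := hf
  have : ∀ n, ∃ c, A c = x n := fun n ↦ by
    have := hx n
    rwa [SetLike.mem_coe, ← Finsupp.range_linearCombination] at this
  choose c hc using this
  have hcau : CauchySeq fun n ↦ B (c n) := by
    have h1 := hxf.cauchySeq
    rw [Metric.cauchySeq_iff] at h1 ⊢
    intro ε hε
    obtain ⟨N, hN⟩ := h1 ε hε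
    refine ⟨N, fun m hm n hn ↦ ?_⟩
    rw [dist_eq_norm, ← map_sub, hnorm, map_sub, hc, hc, ← dist_eq_norm]
    exact hN m hm n hn
  obtain ⟨z, hz⟩ := cauchySeq_tendsto_of_complete hcau
  refine ⟨z, ?_, fun t ↦ ?_⟩
  · rw [← SetLike.mem_coe, Submodule.topologicalClosure_coe]
    refine mem_closure_of_tendsto hz (.of_forall fun n ↦ ?_)
    rw [SetLike.mem_coe, ← Finsupp.range_linearCombination]
    exact ⟨c n, rfl⟩
  · have h1 : Tendsto (fun n ↦ ⟪w t, B (c n)⟫) atTop (𝓝 ⟪w t, z⟫) := tendsto_const_nhds.inner hz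
    have h2 : Tendsto (fun n ↦ ⟪u t, x n⟫) atTop (𝓝 ⟪u t, f⟫) := tendsto_const_nhds.inner hxf
    refine tendsto_nhds_unique h1 (h2.congr fun n ↦ ?_)
    rw [hAB, hc]

theorem mem_closure_span_kerFun {H : Type*} [NormedAddCommGroup H] [InnerProductSpace ℝ H]
    [RKHS ℝ H T ℝ] [CompleteSpace H] (f : H) :
    f ∈ (Submodule.span ℝ (Set.range fun t ↦ RKHS.kerFun H t (1 : ℝ))).topologicalClosure := by
  have h : Submodule.span ℝ {x | ∃ (t : T) (v : ℝ), RKHS.kerFun H t v = x} ≤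
      Submodule.span ℝ (Set.range fun t ↦ RKHS.kerFun H t (1 : ℝ)) := by
    rw [Submodule.span_le]
    rintro _ ⟨t, v, rfl⟩
    have : RKHS.kerFun H t v = v • RKHS.kerFun H t (1 : ℝ) := by
      rw [← map_smul, smul_eq_mul, mul_one]
    rw [this]
    exact Submodule.smul_mem _ _ (Submodule.subset_span ⟨t, rfl⟩)
  have h2 := RKHS.kerFun_dense (𝕜 := ℝ) H
  exact Submodule.topologicalClosure_mono h (h2 ▸ Submodule.mem_top)

/-- Loève's isometry: a function in the reproducing kernel Hilbert space of the covariance kernel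
has the form `t ↦ Cov(X t, Z)` with `Z` jointly Gaussian with the centred process. -/
theorem exists_of_mem_covRKHS [IsProbabilityMeasure P] {X : T → Ω → ℝ}
    (hX : IsGaussianProcess X P) {f : T → ℝ} (hf : f ∈ covRKHS hX) :
    ∃ Z : Ω → ℝ, Measurable Z ∧
      IsGaussianProcess (Sum.elim (fun t ω ↦ X t ω - ∫ ω', X t ω' ∂P) fun _ : Unit ↦ Z) P ∧
      ∀ t, cov[fun ω ↦ X t ω - ∫ ω', X t ω' ∂P, Z; P] = f t := by
  have : Fact (kernelMatrix (covKernel X P)).PosSemidef := ⟨posSemidef_covKernel hX⟩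
  obtain ⟨g, rfl⟩ := hf
  set W : T → Ω → ℝ := fun t ω ↦ X t ω - ∫ ω', X t ω' ∂P with hWdef
  have hW : IsGaussianProcess W P := isGaussianProcess_sub_const hX _
  have hL : ∀ t, MemLp (W t) 2 P := fun t ↦ (hW.hasGaussianLaw_eval t).memLp_two
  have hXi : ∀ t, Integrable (X t) P := fun t ↦ (hX.hasGaussianLaw_eval t).integrable
  have hW0 : ∀ t, ∫ ω, W t ω ∂P = 0 := fun t ↦ by
    simp [W, integral_sub (hXi t)]
  have hcovinner : ∀ t, ∀ z : Lp ℝ 2 P, ⟪(hL t).toLp (W t), z⟫ = cov[W t, z; P] := fun t z ↦ by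
    rw [covariance_eq_sub (hL t) (Lp.memLp z), hW0, zero_mul, sub_zero, L2.inner_def]
    refine integral_congr_ae ?_
    filter_upwards [(hL t).coeFn_toLp] with ω hω
    simp [hω, mul_comm]
  have hgram : ∀ s t, ⟪RKHS.kerFun (RKHS.OfKernel (kernelMatrix (covKernel X P))) s (1 : ℝ),
      RKHS.kerFun (RKHS.OfKernel (kernelMatrix (covKernel X P))) t (1 : ℝ)⟫ =
      ⟪(hL s).toLp (W s), (hL t).toLp (W t)⟫ := fun s t ↦ by
    rw [← RKHS.kernel_inner, RKHS.OfKernel.kernel_ofKernel, L2.inner_def]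
    have : ∫ ω, ⟪(hL s).toLp (W s) ω, (hL t).toLp (W t) ω⟫ ∂P = ∫ ω, W s ω * W t ω ∂P := by
      refine integral_congr_ae ?_
      filter_upwards [(hL s).coeFn_toLp, (hL t).coeFn_toLp] with ω hω hω'
      simp [hω, hω', mul_comm]
    rw [this]
    simp [kernelMatrix, covKernel, covariance, W, mul_comm]
  obtain ⟨z, hz, hzt⟩ := exists_mem_closure_span_inner_eq hgram (mem_closure_span_kerFun g)
  have hzm : Measurable z := (Lp.stronglyMeasurable z).measurable
  refine ⟨z, hzm, ?_, fun t ↦ ?_⟩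
  · have hS : ∀ s : T ⊕ Unit, MemLp ((Sum.elim W fun _ : Unit ↦ ⇑z) s) 2 P := by
      rintro (t | _)
      exacts [hL t, Lp.memLp z]
    refine isGaussianProcess_of_mem_submodule hS _
      (hasGaussianLaw_of_mem_closure_span hW hL) ?_
    rintro (t | _)
    · exact Submodule.le_topologicalClosure _ (Submodule.subset_span ⟨t, rfl⟩)
    · simpa using hz
  · rw [← hcovinner, hzt, RKHS.kerFun_inner]
    simp

/-! ### Covariances along continuous paths -/

theorem sq_covariance_le [IsProbabilityMeasure P] {X Z : Ω → ℝ} (hX : MemLp X 2 P)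
    (hZ : MemLp Z 2 P) : cov[X, Z; P] ^ 2 ≤ Var[X; P] * Var[Z; P] := by
  have h : ∀ a : ℝ, 0 ≤ Var[Z; P] * (a * a) + (2 * cov[X, Z; P]) * a + Var[X; P] := by
    intro a
    have h1 := variance_nonneg (fun ω ↦ X ω + a * Z ω) P
    rw [variance_fun_add hX (hZ.const_mul a), covariance_const_mul_right, variance_const_mul] at h1
    linarith
  -- `Var (X + a * Z) ≥ 0` for all real `a`
  have h2 := discrim_le_zero h
  rw [discrim] at h2
  linarith

/-- For a Gaussian process with continuous paths the variances of increments vanish in the limit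
`s → t`: the modulus of the
characteristic function of `X s - X t` at `1` is `exp (-Var / 2)`, and it tends to `1`. -/
theorem tendsto_variance_sub_nhds {E : Type*} [TopologicalSpace E] [FirstCountableTopology E]
    {X : E → Ω → ℝ} (hX : IsGaussianProcess X P) (hc : ∀ᵐ ω ∂P, Continuous fun s ↦ X s ω) (t : E) :
    Tendsto (fun s ↦ Var[fun ω ↦ X s ω - X t ω; P]) (𝓝 t) (𝓝 0) := by
  have := hX.isProbabilityMeasure
  have hG : ∀ s, HasGaussianLaw (fun ω ↦ X s ω - X t ω) P := fun s ↦ hX.hasGaussianLaw_fun_sub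
  have h1 := tendsto_charFun_of_ae_tendsto (P := P) (l := 𝓝 t) (Y := fun _ ↦ 0)
    (fun s ↦ (hG s).aemeasurable) aemeasurable_const (by
      filter_upwards [hc] with ω hω
      have := (hω.tendsto t).sub_const (X t ω)
      rwa [sub_self] at this) 1
  have h2 : ∀ s, ‖charFun (P.map fun ω ↦ X s ω - X t ω) 1‖ =
      Real.exp (-(Var[fun ω ↦ X s ω - X t ω; P] / 2)) := fun s ↦ by
    rw [charFun_map_eq_of_hasGaussianLaw (hG s), Complex.norm_exp]
    simp
  have h3 : ‖charFun (P.map fun _ ↦ (0 : ℝ)) 1‖ = 1 := by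
    simp [Measure.map_const, charFun_dirac]
  have h4 := h1.norm
  simp only [h2, h3] at h4
  have h5 := (h4.log one_ne_zero).const_mul (-2)
  simp only [Real.log_exp, Real.log_one, mul_zero] at h5
  refine h5.congr fun s ↦ ?_
  ring

/-- A Gaussian process with continuous paths is continuous in `L²`, so its covariance with any
square-integrable variable is continuous in the index. -/
theorem continuous_covariance_right {E : Type*} [TopologicalSpace E] [FirstCountableTopology E]
    {X : E → Ω → ℝ} (hX : IsGaussianProcess X P) (hc : ∀ᵐ ω ∂P, Continuous fun s ↦ X s ω)
    {Z : Ω → ℝ} (hZ : MemLp Z 2 P) : Continuous fun s ↦ cov[X s, Z; P] := by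
  have := hX.isProbabilityMeasure
  have hL : ∀ t, MemLp (X t) 2 P := fun t ↦ (hX.hasGaussianLaw_eval t).memLp_two
  refine continuous_iff_continuousAt.mpr fun t ↦ ?_
  rw [ContinuousAt, tendsto_iff_dist_tendsto_zero]
  have h1 := ((tendsto_variance_sub_nhds hX hc t).mul_const Var[Z; P]).sqrt
  rw [zero_mul, Real.sqrt_zero] at h1
  refine squeeze_zero (fun _ ↦ dist_nonneg) (fun s ↦ ?_) h1
  rw [Real.dist_eq, ← covariance_fun_sub_left (hL s) (hL t) hZ]
  exact Real.abs_le_sqrt (sq_covariance_le ((hL s).sub (hL t)) hZ)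

/-! ### Ties between suprema of processes linear in an independent variable -/

/-- If the slopes `p` of one family of affine functions exceed the slopes `q` of another by a fixed
margin, the suprema of the two families agree for at most one argument. -/
theorem eq_of_iSup_eq_iSup {ι κ : Type*} [Nonempty ι] [Nonempty κ] {u p : ι → ℝ} {v q : κ → ℝ}
    {α β z z' : ℝ} (hβα : β < α) (hp : ∀ i, α ≤ p i) (hq : ∀ k, q k ≤ β)
    (hu : BddAbove (Set.range fun i ↦ u i + p i * z))
    (hv : BddAbove (Set.range fun k ↦ v k + q k * z))
    (hu' : BddAbove (Set.range fun i ↦ u i + p i * z'))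
    (hv' : BddAbove (Set.range fun k ↦ v k + q k * z'))
    (h : ⨆ i, (u i + p i * z) = ⨆ k, (v k + q k * z))
    (h' : ⨆ i, (u i + p i * z') = ⨆ k, (v k + q k * z')) : z = z' := by
  wlog hzz : z ≤ z' generalizing z z'
  · exact (this hu' hv' hu hv h' h (le_of_not_ge hzz)).symm
  by_contra hne
  have hlt : z < z' := lt_of_le_of_ne hzz hne
  have h1 : ⨆ i, (u i + p i * z) ≤ (⨆ i, (u i + p i * z')) - α * (z' - z) := by
    refine ciSup_le fun i ↦ ?_
    have := le_ciSup hu' i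
    nlinarith [hp i]
  have h2 : ⨆ k, (v k + q k * z') ≤ (⨆ k, (v k + q k * z)) + β * (z' - z) := by
    refine ciSup_le fun k ↦ ?_
    have := le_ciSup hv k
    nlinarith [hq k]
  nlinarith

/-- Ties between two suprema of `R + h * Z` are null events when the slopes `h` along the sequences
`a` and `b` are separated and `Z` is atomless and independent of `R`. Boundedness is part of the
event because an unbounded real supremum is `0` by convention. -/
theorem measure_iSup_eq_iSup_eq_zero [IsProbabilityMeasure P] {R : T → Ω → ℝ} {Z : Ω → ℝ}
    (hR : ∀ t, Measurable (R t)) (hZ : Measurable Z) (hind : IndepFun Z (fun ω t ↦ R t ω) P)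
    (hatom : ∀ z, P.map Z {z} = 0) (h : T → ℝ) (a b : ℕ → T) {α β : ℝ} (hβα : β < α)
    (ha : ∀ n, α ≤ h (a n)) (hb : ∀ n, h (b n) ≤ β) :
    P {ω | BddAbove (Set.range fun n ↦ R (a n) ω + h (a n) * Z ω) ∧
      BddAbove (Set.range fun n ↦ R (b n) ω + h (b n) * Z ω) ∧
      ⨆ n, (R (a n) ω + h (a n) * Z ω) = ⨆ n, (R (b n) ω + h (b n) * Z ω)} = 0 := by
  set S : Set (ℝ × (T → ℝ)) := {p | BddAbove (Set.range fun n ↦ p.2 (a n) + h (a n) * p.1) ∧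
      BddAbove (Set.range fun n ↦ p.2 (b n) + h (b n) * p.1) ∧
      ⨆ n, (p.2 (a n) + h (a n) * p.1) = ⨆ n, (p.2 (b n) + h (b n) * p.1)} with hS
  have hm : ∀ (c : ℕ → T) n, Measurable fun p : ℝ × (T → ℝ) ↦ p.2 (c n) + h (c n) * p.1 :=
    fun c n ↦ ((measurable_pi_apply _).comp measurable_snd).add (measurable_fst.const_mul _)
  have hSm : MeasurableSet S :=
    (measurableSet_bddAbove_range (hm a)).inter ((measurableSet_bddAbove_range (hm b)).inter
      (measurableSet_eq_fun (.iSup (hm a)) (.iSup (hm b))))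
  have hRm : Measurable fun ω t ↦ R t ω := measurable_pi_lambda _ hR
  have h1 : P ((fun ω ↦ (Z ω, fun t ↦ R t ω)) ⁻¹' S) = 0 := by
    rw [← Measure.map_apply (hZ.prodMk hRm) hSm,
      hind.map_prod_eq_prod_map_map hZ.aemeasurable hRm.aemeasurable]
    have : IsProbabilityMeasure (P.map Z) := P.isProbabilityMeasure_map hZ.aemeasurable
    have : IsProbabilityMeasure (P.map fun ω t ↦ R t ω) :=
      P.isProbabilityMeasure_map hRm.aemeasurable
    rw [Measure.prod_apply_symm hSm, lintegral_eq_zero_iff (measurable_measure_prodMk_right hSm)]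
    refine ae_of_all _ fun w ↦ ?_
    have hsub : ((fun x ↦ (x, w)) ⁻¹' S).Subsingleton := by
      rintro z ⟨hz1, hz2, hz3⟩ z' ⟨hz1', hz2', hz3'⟩
      exact eq_of_iSup_eq_iSup hβα ha hb hz1 hz2 hz1' hz2' hz3 hz3'
    rcases hsub.eq_empty_or_singleton with h0 | ⟨z, h0⟩
    · simp [h0]
    · simpa [h0] using hatom z
  exact h1

/-! ### Almost sure uniqueness of maximizers -/

theorem exists_seq_dense_in {E : Type*} [TopologicalSpace E] [SecondCountableTopology E]
    {K : Set E} (hK : K.Nonempty) :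
    ∃ a : ℕ → E, (∀ n, a n ∈ K) ∧ K ⊆ closure (Set.range a) := by
  have : Nonempty K := hK.to_subtype
  refine ⟨fun n ↦ (TopologicalSpace.denseSeq K n : E), fun n ↦ Subtype.coe_prop _, fun x hx ↦ ?_⟩
  have h1 : (⟨x, hx⟩ : K) ∈ closure (Set.range (TopologicalSpace.denseSeq K)) :=
    TopologicalSpace.denseRange_denseSeq K _
  have h2 := image_closure_subset_closure_image (continuous_subtype_val (p := (· ∈ K)))
    (Set.mem_image_of_mem _ h1)
  rwa [← Set.range_comp] at h2

theorem le_of_dense_seq {E : Type*} [TopologicalSpace E] {K : Set E} {a : ℕ → E}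
    (haK : K ⊆ closure (Set.range a)) {g : E → ℝ} (hg : Continuous g) {M : ℝ}
    (hM : ∀ n, g (a n) ≤ M) {x : E} (hx : x ∈ K) : g x ≤ M := by
  have h1 : closure (Set.range a) ⊆ {x | g x ≤ M} :=
    closure_minimal (by rintro _ ⟨n, rfl⟩; exact hM n) (isClosed_le hg continuous_const)
  exact h1 (haK hx)

theorem iSup_dense_seq_eq {E : Type*} [TopologicalSpace E] {K : Set E} {a : ℕ → E}
    (ha : ∀ n, a n ∈ K) (haK : K ⊆ closure (Set.range a)) {g : E → ℝ} (hg : Continuous g)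
    {y : E} (hy : y ∈ K) (hmax : ∀ x ∈ K, g x ≤ g y) :
    BddAbove (Set.range fun n ↦ g (a n)) ∧ ⨆ n, g (a n) = g y := by
  have hb : BddAbove (Set.range fun n ↦ g (a n)) := ⟨g y, by
    rintro _ ⟨n, rfl⟩; exact hmax _ (ha n)⟩
  exact ⟨hb, le_antisymm (ciSup_le fun n ↦ hmax _ (ha n))
    (le_of_dense_seq haK hg (fun n ↦ le_ciSup hb n) hy)⟩

/-- Distinct points `s` and `t` of `K` have neighbourhoods that almost surely do not both contain
a maximizer over `K`. -/
theorem exists_nhds_measure_two_maximizers_eq_zero {E : Type*} [TopologicalSpace E]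
    [SecondCountableTopology E] {X : E → Ω → ℝ} (hX : IsGaussianProcess X P)
    (hm : ∀ s, Measurable (X s)) (hc : ∀ ω, Continuous fun s ↦ X s ω) (K : Set E) {s t : E}
    (hs : s ∈ K) (ht : t ∈ K) (hv : Var[fun ω ↦ X s ω - X t ω; P] ≠ 0) :
    ∃ U ∈ 𝓝 s, ∃ V ∈ 𝓝 t, P {ω | ∃ x ∈ U ∩ K, ∃ y ∈ V ∩ K,
      (∀ z ∈ K, X z ω ≤ X x ω) ∧ ∀ z ∈ K, X z ω ≤ X y ω} = 0 := by
  have := hX.isProbabilityMeasure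
  set Z : Ω → ℝ := fun ω ↦ X s ω - X t ω with hZ
  have hZm : Measurable Z := (hm s).sub (hm t)
  have hZG : HasGaussianLaw Z P := hX.hasGaussianLaw_fun_sub
  have hL : ∀ t, MemLp (X t) 2 P := fun t ↦ (hX.hasGaussianLaw_eval t).memLp_two
  have hjoint : IsGaussianProcess (Sum.elim X fun _ : Unit ↦ Z) P := by
    convert! isGaussianProcess_linear_pair hX (S := E ⊕ Unit) (fun _ ↦ 1)
      (Sum.elim (fun _ ↦ 0) fun _ ↦ -1) (Sum.elim id fun _ ↦ s) (Sum.elim id fun _ ↦ t) with u ω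
    rcases u with u | u <;> simp [Z, sub_eq_add_neg]
  set h : E → ℝ := fun x ↦ cov[X x, Z; P] / Var[Z; P] with hh
  have hhc : Continuous h :=
    (continuous_covariance_right hX (ae_of_all _ hc) hZG.memLp_two).div_const _
  have hst : h s = h t + 1 := by
    have : cov[X s, Z; P] = cov[X t, Z; P] + Var[Z; P] := by
      rw [← covariance_self hZm.aemeasurable]
      conv_rhs => rw [hZ, covariance_fun_sub_left (hL s) (hL t) hZG.memLp_two]
      ring
    simp only [h, this]
    field_simp
  have hU : {x | h s - 1 / 3 < h x} ∈ 𝓝 s :=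
    (isOpen_lt continuous_const hhc).mem_nhds (by simp)
  have hV : {x | h x < h t + 1 / 3} ∈ 𝓝 t :=
    (isOpen_lt hhc continuous_const).mem_nhds (by simp)
  obtain ⟨a, ha, hadense⟩ := exists_seq_dense_in (K := {x | h s - 1 / 3 < h x} ∩ K)
    ⟨s, mem_of_mem_nhds hU, hs⟩
  obtain ⟨b, hb, hbdense⟩ := exists_seq_dense_in (K := {x | h x < h t + 1 / 3} ∩ K)
    ⟨t, mem_of_mem_nhds hV, ht⟩
  refine ⟨_, hU, _, hV, measure_mono_null ?_
    (measure_iSup_eq_iSup_eq_zero (R := fun x ω ↦ X x ω - h x * Z ω) (Z := Z)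
      (fun x ↦ (hm x).sub (hZm.const_mul _)) hZm (indepFun_sub_regression hjoint hv) ?_ h a b
      (α := h s - 1 / 3) (β := h t + 1 / 3) (by linarith) (fun n ↦ (ha n).1.le)
      (fun n ↦ (hb n).1.le))⟩
  · rintro ω ⟨x, hx, y, hy, hxmax, hymax⟩
    simp only [sub_add_cancel, Set.mem_ofPred_eq]
    obtain ⟨h1, h2⟩ := iSup_dense_seq_eq ha hadense (hc ω) hx fun z hz ↦ hxmax z hz.2
    obtain ⟨h3, h4⟩ := iSup_dense_seq_eq hb hbdense (hc ω) hy fun z hz ↦ hymax z hz.2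
    refine ⟨h1, h3, ?_⟩
    rw [h2, h4]
    exact le_antisymm (hymax x hx.2) (hxmax y hy.2)
  · intro z
    have hv' : Var[Z; P].toNNReal ≠ 0 := by
      simpa using lt_of_le_of_ne (variance_nonneg Z P) (Ne.symm hv)
    have := nullSingletonClass_gaussianReal (μ := P[Z]) hv'
    rw [hZG.map_eq_gaussianReal]
    exact measure_singleton z

/-- Almost surely, a continuous Gaussian process with non-degenerate increments has at most one
maximizer over any given set. -/
theorem ae_maximizer_unique {E : Type*} [TopologicalSpace E] [SecondCountableTopology E]
    {X : E → Ω → ℝ} (hX : IsGaussianProcess X P) (hm : ∀ s, Measurable (X s))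
    (hc : ∀ ω, Continuous fun s ↦ X s ω)
    (hv : ∀ s t, s ≠ t → Var[fun ω ↦ X s ω - X t ω; P] ≠ 0) (K : Set E) :
    ∀ᵐ ω ∂P, ∀ s ∈ K, ∀ t ∈ K, (∀ z ∈ K, X z ω ≤ X s ω) → (∀ z ∈ K, X z ω ≤ X t ω) → s = t := by
  have key : ∀ p : E × E, ∃ W : Set (E × E), p ∈ {p : E × E | p.1 ∈ K ∧ p.2 ∈ K ∧ p.1 ≠ p.2} →
      W ∈ 𝓝 p ∧ P {ω | ∃ q ∈ W, q.1 ∈ K ∧ q.2 ∈ K ∧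
        (∀ z ∈ K, X z ω ≤ X q.1 ω) ∧ ∀ z ∈ K, X z ω ≤ X q.2 ω} = 0 := by
    intro p
    by_cases hp : p ∈ {p : E × E | p.1 ∈ K ∧ p.2 ∈ K ∧ p.1 ≠ p.2}
    · obtain ⟨U, hU, V, hV, h0⟩ := exists_nhds_measure_two_maximizers_eq_zero hX hm hc K
        hp.1 hp.2.1 (hv _ _ hp.2.2)
      refine ⟨U ×ˢ V, fun _ ↦ ⟨prod_mem_nhds hU hV, measure_mono_null ?_ h0⟩⟩
      rintro ω ⟨q, hq, hq1, hq2, hm1, hm2⟩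
      exact ⟨q.1, ⟨hq.1, hq1⟩, q.2, ⟨hq.2, hq2⟩, hm1, hm2⟩
    · exact ⟨∅, fun h ↦ absurd h hp⟩
  choose W hW using key
  obtain ⟨C, hCs, hCc, hC⟩ := TopologicalSpace.countable_cover_nhdsWithin (f := W)
    fun p hp ↦ mem_nhdsWithin_of_mem_nhds (hW p hp).1
  have hall : ∀ᵐ ω ∂P, ∀ p ∈ C, ¬ ∃ q ∈ W p, q.1 ∈ K ∧ q.2 ∈ K ∧
      (∀ z ∈ K, X z ω ≤ X q.1 ω) ∧ ∀ z ∈ K, X z ω ≤ X q.2 ω := by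
    refine (ae_ball_iff hCc).mpr fun p hp ↦ ?_
    rw [ae_iff]
    simpa only [not_not] using (hW p (hCs hp)).2
  filter_upwards [hall] with ω hω s hs t ht hsm htm
  by_contra hne
  obtain ⟨p, hp, hpW⟩ := Set.mem_iUnion₂.mp (hC (show (s, t) ∈ _ from ⟨hs, ht, hne⟩))
  exact hω p hp ⟨(s, t), hpW, hs, ht, hsm, htm⟩

/-! ### Maxima of processes with stationary increments -/

/-- For continuous functions, attaining the supremum over `Q` at a point of a compact set `H` is a
condition on countably many values. -/
theorem exists_dominating_iff_iSup_le {E : Type*} [TopologicalSpace E] {H Q : Set E} {a b : ℕ → E}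
    (ha : ∀ n, a n ∈ Q) (hadense : Q ⊆ closure (Set.range a))
    (hb : ∀ n, b n ∈ H) (hbdense : H ⊆ closure (Set.range b)) (hH : IsCompact H)
    {g : E → ℝ} (hg : Continuous g) (hQ : BddAbove (g '' Q)) :
    (∃ y ∈ H, ∀ x ∈ Q, g x ≤ g y) ↔ ⨆ n, g (a n) ≤ ⨆ n, g (b n) := by
  have hba : BddAbove (Set.range fun n ↦ g (a n)) :=
    hQ.mono (by rintro _ ⟨n, rfl⟩; exact ⟨a n, ha n, rfl⟩)
  obtain ⟨y, hy, hymax⟩ := hH.exists_isMaxOn ⟨b 0, hb 0⟩ hg.continuousOn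
  obtain ⟨-, hby⟩ := iSup_dense_seq_eq hb hbdense hg hy hymax
  constructor
  · rintro ⟨y', hy', h⟩
    rw [hby]
    exact ciSup_le fun n ↦ (h _ (ha n)).trans (hymax hy')
  · intro h
    rw [hby] at h
    exact ⟨y, hy, fun x hx ↦ le_of_dense_seq hadense hg (fun n ↦ (le_ciSup hba n).trans h) hx⟩

theorem measurableSet_iSup_le (a b : ℕ → T) :
    MeasurableSet {g : T → ℝ | ⨆ n, g (a n) ≤ ⨆ n, g (b n)} :=
  measurableSet_le (.iSup fun n ↦ measurable_pi_apply (a n))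
    (.iSup fun n ↦ measurable_pi_apply (b n))

/-- For a centred continuous Gaussian process with stationary, non-degenerate increments, let `H`
be a compact set with infinitely many pairwise disjoint translates `v k + H`, each of them inside
all translates `v l + Q` of a compact window `Q`. Then almost surely no point of `H` maximizes the
process over `Q`: by stationarity the event has the same probability for all
translates, and for two different translates the events exclude each other, since the two windows
would share two distinct maximizers. -/
theorem measure_max_in_subset_eq_zero {E : Type*} [TopologicalSpace E]
    [SecondCountableTopology E] [AddCommGroup E] [ContinuousAdd E]
    {W : E → Ω → ℝ} (hW : IsGaussianProcess W P) (hm : ∀ s, Measurable (W s))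
    (hc : ∀ ω, Continuous fun s ↦ W s ω) (h0 : ∀ s, ∫ ω, W s ω ∂P = 0)
    (hv : ∀ s t, s ≠ t → Var[fun ω ↦ W s ω - W t ω; P] ≠ 0)
    (hstat : ∀ s t h, h ≠ 0 →
      cov[fun ω ↦ W (h + s) ω - W h ω, fun ω ↦ W (h + t) ω - W h ω; P] = cov[W s, W t; P])
    {H Q : Set E} (hH : IsCompact H) (hQ : IsCompact Q) (v : ℕ → E) (hv0 : ∀ k, v k ≠ 0)
    (hHQ : ∀ k l, ∀ y ∈ H, v k + y - v l ∈ Q)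
    (hdisj : ∀ k l, k ≠ l → ∀ y ∈ H, ∀ y' ∈ H, v k + y ≠ v l + y') :
    P {ω | ∃ y ∈ H, ∀ x ∈ Q, W x ω ≤ W y ω} = 0 := by
  have := hW.isProbabilityMeasure
  rcases H.eq_empty_or_nonempty with rfl | hHne
  · simp
  have hQne : Q.Nonempty := hHne.imp fun y hy ↦ by simpa using hHQ 0 0 y hy
  obtain ⟨a, ha, had⟩ := exists_seq_dense_in hQne
  obtain ⟨b, hb, hbd⟩ := exists_seq_dense_in hHne
  set D : Set (E → ℝ) := {g | ⨆ n, g (a n) ≤ ⨆ n, g (b n)} with hD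
  have hDm : MeasurableSet D := measurableSet_iSup_le a b
  have hiff : ∀ g : E → ℝ, Continuous g → ((∃ y ∈ H, ∀ x ∈ Q, g x ≤ g y) ↔ g ∈ D) := fun g hg ↦
    exists_dominating_iff_iSup_le ha had hb hbd hH hg (hQ.bddAbove_image hg.continuousOn)
  set A : ℕ → Set Ω := fun k ↦ {ω | ∃ y ∈ H, ∀ x ∈ Q, W (v k + x) ω ≤ W (v k + y) ω} with hA
  have hA' : ∀ k, A k = (fun ω s ↦ W (v k + s) ω - W (v k) ω) ⁻¹' D := by
    intro k
    ext ω
    have : Continuous fun s ↦ W (v k + s) ω - W (v k) ω :=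
      ((hc ω).comp (continuous_const.add continuous_id)).sub continuous_const
    rw [Set.mem_preimage, ← hiff _ this]
    simp [A]
  have hWm : Measurable fun ω s ↦ W s ω := measurable_pi_lambda _ hm
  have hSm : ∀ k, ∀ s, Measurable fun ω ↦ W (v k + s) ω - W (v k) ω := fun k s ↦
    (hm _).sub (hm _)
  have hWi : ∀ s, Integrable (W s) P := fun s ↦ (hW.hasGaussianLaw_eval s).integrable
  have hPA : ∀ k, P (A k) = P {ω | ∃ y ∈ H, ∀ x ∈ Q, W x ω ≤ W y ω} := by
    intro k
    have hlaw := map_eq_of_mean_eq_of_covariance_eq (hW.shift (v k)) hW (hSm k) hm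
      (fun s ↦ by rw [integral_sub (hWi _) (hWi _), h0, h0, h0, sub_zero])
      (fun s t ↦ hstat s t _ (hv0 k))
    rw [hA', ← Measure.map_apply (measurable_pi_lambda _ (hSm k)) hDm, hlaw,
      Measure.map_apply hWm hDm]
    congr 1
    ext ω
    exact (hiff _ (hc ω)).symm
  have hAm : ∀ k, MeasurableSet (A k) := fun k ↦ by
    rw [hA']
    exact measurable_pi_lambda _ (hSm k) hDm
  -- for `k ≠ l` the two maximizers both lie in the intersection of the two windows
  have hAd : Pairwise (Function.onFun (AEDisjoint P) A) := by
    intro k l hkl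
    have hu := ae_maximizer_unique hW hm hc hv {z | z - v k ∈ Q ∧ z - v l ∈ Q}
    refine measure_mono_null ?_ (ae_iff.mp hu)
    rintro ω ⟨⟨y, hy, hymax⟩, ⟨y', hy', hymax'⟩⟩ hun
    refine hdisj k l hkl y hy y' hy' (hun _ ⟨hHQ k k y hy, hHQ k l y hy⟩ _
      ⟨hHQ l k y' hy', hHQ l l y' hy'⟩ (fun z hz ↦ ?_) fun z hz ↦ ?_)
    · simpa using hymax _ hz.1
    · simpa using hymax' _ hz.2
  by_contra hne
  have h1 := measure_iUnion₀ hAd fun k ↦ (hAm k).nullMeasurableSet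
  simp only [hPA] at h1
  rw [ENNReal.tsum_const_eq_top_of_ne_zero hne] at h1
  exact measure_ne_top P _ h1

/-! ### Modification with continuous paths -/

/-- A process whose paths are almost surely continuous is indistinguishable from one with
measurable values and continuous paths. -/
theorem exists_continuous_modification {E : Type*} [TopologicalSpace E]
    [SecondCountableTopology E] {X : E → Ω → ℝ}
    (hm : ∀ s, AEMeasurable (X s) P) (hc : ∀ᵐ ω ∂P, Continuous fun s ↦ X s ω) :
    ∃ Y : E → Ω → ℝ, (∀ s, Measurable (Y s)) ∧ (∀ ω, Continuous fun s ↦ Y s ω) ∧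
      ∀ᵐ ω ∂P, ∀ s, X s ω = Y s ω := by
  classical
  obtain ⟨D, hDc, hDd⟩ := TopologicalSpace.exists_countable_dense E
  have hgood : ∀ᵐ ω ∂P, (Continuous fun s ↦ X s ω) ∧ ∀ q ∈ D, X q ω = (hm q).mk (X q) ω :=
    hc.and ((ae_ball_iff hDc).mpr fun q _ ↦ (hm q).ae_eq_mk)
  obtain ⟨S, hSsub, hSm, hS0⟩ := exists_measurable_superset_of_null (ae_iff.mp hgood)
  -- outside the null set `S`, each value is a limit of measurable values at points of `D`
  have hS : ∀ ω ∉ S, (Continuous fun s ↦ X s ω) ∧ ∀ q ∈ D, X q ω = (hm q).mk (X q) ω :=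
    fun ω hω ↦ by_contra fun h ↦ hω (hSsub h)
  refine ⟨fun s ω ↦ if ω ∈ S then 0 else X s ω, fun s ↦ ?_, fun ω ↦ ?_, ?_⟩
  · obtain ⟨q, hqD, hqs⟩ := mem_closure_iff_seq_limit.mp (hDd s)
    refine measurable_of_tendsto_metrizable
      (f := fun n ω ↦ if ω ∈ S then 0 else (hm (q n)).mk (X (q n)) ω)
      (fun n ↦ Measurable.ite hSm measurable_const (hm (q n)).measurable_mk) ?_
    rw [tendsto_pi_nhds]
    intro ω
    by_cases hω : ω ∈ S
    · simp [hω]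
    · simp only [hω, if_false]
      refine (((hS ω hω).1.tendsto s).comp hqs).congr fun n ↦ ?_
      exact (hS ω hω).2 _ (hqD n)
  · by_cases hω : ω ∈ S
    · simpa [hω] using continuous_const
    · simpa [hω] using (hS ω hω).1
  · have : ∀ᵐ ω ∂P, ω ∉ S := measure_eq_zero_iff_ae_notMem.mp hS0
    filter_upwards [this] with ω hω s
    simp [hω]

/-! ### Processes with a mean in the reproducing kernel Hilbert space -/

theorem exists_cube_mem_nhds {d : ℕ} (s : Fin d → ℝ) : ∃ N : ℕ, cube d N ∈ 𝓝 s := by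
  obtain ⟨N, hN⟩ := exists_nat_gt ‖s‖
  refine ⟨N, ?_⟩
  have h1 : {x : Fin d → ℝ | ‖x‖ < N} ∈ 𝓝 s :=
    (isOpen_lt continuous_norm continuous_const).mem_nhds hN
  filter_upwards [h1] with x hx
  have h2 : ∀ i, |x i| ≤ N := fun i ↦ (norm_le_pi_norm x i).trans hx.le
  exact ⟨fun i ↦ (abs_le.mp (h2 i)).1, fun i ↦ (abs_le.mp (h2 i)).2⟩

theorem exists_cube_superset {d : ℕ} {K : Set (Fin d → ℝ)} (hK : IsCompact K) :
    ∃ N : ℕ, K ⊆ cube d N := by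
  obtain ⟨C, hC⟩ := hK.isBounded.exists_norm_le
  obtain ⟨N, hN⟩ := exists_nat_ge C
  refine ⟨N, fun x hx ↦ ?_⟩
  have h2 : ∀ i, |x i| ≤ N := fun i ↦ (norm_le_pi_norm x i).trans ((hC x hx).trans hN)
  exact ⟨fun i ↦ (abs_le.mp (h2 i)).1, fun i ↦ (abs_le.mp (h2 i)).2⟩

/-- The mean is continuous because on each cube it is a covariance with a fixed variable. -/
theorem continuous_mean_of_representers {d : ℕ} {G : (Fin d → ℝ) → Ω → ℝ}
    (hG : IsGaussianProcess G P) (hc : ∀ ω, Continuous fun s ↦ G s ω)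
    (hZ : ∀ N, ∃ Z : Ω → ℝ, MemLp Z 2 P ∧ ∀ t ∈ cube d N, cov[G t, Z; P] = ∫ ω, G t ω ∂P) :
    Continuous fun t ↦ ∫ ω, G t ω ∂P := by
  refine continuous_iff_continuousAt.mpr fun t ↦ ?_
  obtain ⟨N, hN⟩ := exists_cube_mem_nhds t
  obtain ⟨Z, hZ2, hZt⟩ := hZ N
  refine (continuous_covariance_right hG (ae_of_all _ hc) hZ2).continuousAt.congr ?_
  filter_upwards [hN] with s hs using hZt s hs

theorem variance_sub_ne_zero {E : Type*} [AddCommGroup E] {G : E → Ω → ℝ}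
    (hG : IsGaussianProcess G P) (hpos : ∀ h : E, h ≠ 0 → 0 < cov[G h, G h; P])
    (hshift : ∀ s t h : E, h ≠ 0 →
      cov[G (h + s), G (h + t); P] - cov[G (h + s), G h; P] - cov[G h, G (h + t); P]
        + cov[G h, G h; P] = cov[G s, G t; P])
    (s t : E) (hst : s ≠ t) : Var[fun ω ↦ G s ω - G t ω; P] ≠ 0 := by
  have := hG.isProbabilityMeasure
  have hL : ∀ t, MemLp (G t) 2 P := fun t ↦ (hG.hasGaussianLaw_eval t).memLp_two
  have key : ∀ s t, s ≠ t → t ≠ 0 → Var[fun ω ↦ G s ω - G t ω; P] ≠ 0 := by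
    intro s t hst ht
    have hsub : AEMeasurable (fun ω ↦ G s ω - G t ω) P := ((hL s).sub (hL t)).aemeasurable
    rw [← covariance_self hsub,
      covariance_fun_sub_fun_sub (hL s) (hL t) (hL s) (hL t)]
    have h1 := hshift (s - t) (s - t) t ht
    rw [add_sub_cancel] at h1
    rw [h1]
    exact (hpos _ (sub_ne_zero.mpr hst)).ne'
  -- the shift identity at `t` needs `t ≠ 0`; otherwise it is used at `s`
  by_cases ht : t = 0
  · have h1 := key t s hst.symm (ht ▸ hst)
    rwa [← variance_fun_neg, show (fun ω ↦ -(G t ω - G s ω)) = fun ω ↦ G s ω - G t ω by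
      ext ω; ring] at h1
  · exact key s t hst ht

/-- The conclusion of `measure_max_in_subset_eq_zero` for a process whose mean lies in the
reproducing kernel Hilbert space on each cube, expressed through the representing variables `Z`. -/
theorem measure_max_in_subset_eq_zero_of_representers {d : ℕ} {G : (Fin d → ℝ) → Ω → ℝ}
    (hG : IsGaussianProcess G P) (hm : ∀ s, Measurable (G s)) (hc : ∀ ω, Continuous fun s ↦ G s ω)
    (hpos : ∀ h : Fin d → ℝ, h ≠ 0 → 0 < cov[G h, G h; P])
    (hshift : ∀ s t h : Fin d → ℝ, h ≠ 0 →
      cov[G (h + s), G (h + t); P] - cov[G (h + s), G h; P] - cov[G h, G (h + t); P]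
        + cov[G h, G h; P] = cov[G s, G t; P])
    (hZ : ∀ N, ∃ Z : Ω → ℝ, Measurable Z ∧ IsGaussianProcess
      (Sum.elim (fun (t : cube d N) ω ↦ G t ω - ∫ ω', G t ω' ∂P) fun _ : Unit ↦ Z) P ∧
      ∀ t ∈ cube d N, cov[G t, Z; P] = ∫ ω, G t ω ∂P)
    {H Q : Set (Fin d → ℝ)} (hH : IsCompact H) (hQ : IsCompact Q) (v : ℕ → Fin d → ℝ)
    (hv0 : ∀ k, v k ≠ 0) (hHQ : ∀ k l, ∀ y ∈ H, v k + y - v l ∈ Q)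
    (hdisj : ∀ k l, k ≠ l → ∀ y ∈ H, ∀ y' ∈ H, v k + y ≠ v l + y') :
    P {ω | ∃ y ∈ H, ∀ x ∈ Q, G x ω ≤ G y ω} = 0 := by
  have := hG.isProbabilityMeasure
  have hL : ∀ t, MemLp (G t) 2 P := fun t ↦ (hG.hasGaussianLaw_eval t).memLp_two
  have hi : ∀ t, Integrable (G t) P := fun t ↦ (hG.hasGaussianLaw_eval t).integrable
  have hmean : Continuous fun t ↦ ∫ ω, G t ω ∂P :=
    continuous_mean_of_representers hG hc fun N ↦ by
      obtain ⟨Z, -, hZG, hZt⟩ := hZ N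
      exact ⟨Z, (hZG.hasGaussianLaw_eval (.inr ())).memLp_two, hZt⟩
  set W : (Fin d → ℝ) → Ω → ℝ := fun t ω ↦ G t ω - ∫ ω', G t ω' ∂P with hWdef
  have hW : IsGaussianProcess W P := isGaussianProcess_sub_const hG _
  have hWm : ∀ t, Measurable (W t) := fun t ↦ (hm t).sub_const _
  have hWc : ∀ ω, Continuous fun t ↦ W t ω := fun ω ↦ (hc ω).sub hmean
  have hWL : ∀ t, MemLp (W t) 2 P := fun t ↦ (hW.hasGaussianLaw_eval t).memLp_two
  have hWcov : ∀ s t, cov[W s, W t; P] = cov[G s, G t; P] := fun s t ↦ by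
    rw [hWdef, covariance_sub_const_left (hi s), covariance_sub_const_right (hi t)]
  have hW0 : P {ω | ∃ y ∈ H, ∀ x ∈ Q, W x ω ≤ W y ω} = 0 := by
    refine measure_max_in_subset_eq_zero hW hWm hWc (fun t ↦ ?_) ?_ ?_ hH hQ v hv0 hHQ hdisj
    · simp [W, integral_sub (hi t)]
    · exact variance_sub_ne_zero hW (by simpa only [hWcov] using hpos)
        (by simpa only [hWcov] using hshift)
    · intro s t h hh
      rw [covariance_fun_sub_fun_sub (hWL _) (hWL _) (hWL _) (hWL _)]
      simp only [hWcov]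
      exact hshift s t h hh
  rcases H.eq_empty_or_nonempty with rfl | hHne
  · simp
  have hHsub : H ⊆ Q := fun y hy ↦ by simpa using hHQ 0 0 y hy
  obtain ⟨a, ha, had⟩ := exists_seq_dense_in (hHne.mono hHsub)
  obtain ⟨b, hb, hbd⟩ := exists_seq_dense_in hHne
  obtain ⟨N, hN⟩ := exists_cube_superset hQ
  set a' : ℕ → cube d N := fun n ↦ ⟨a n, hN (ha n)⟩
  set b' : ℕ → cube d N := fun n ↦ ⟨b n, hN (hHsub (hb n))⟩
  set D : Set (cube d N → ℝ) := {g | ⨆ n, g (a' n) ≤ ⨆ n, g (b' n)}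
  have hDm : MeasurableSet D := measurableSet_iSup_le a' b'
  have hpre : ∀ X : (Fin d → ℝ) → Ω → ℝ, (∀ ω, Continuous fun t ↦ X t ω) →
      {ω | ∃ y ∈ H, ∀ x ∈ Q, X x ω ≤ X y ω} = (fun ω (t : cube d N) ↦ X t ω) ⁻¹' D := by
    intro X hX
    ext ω
    exact exists_dominating_iff_iSup_le ha had hb hbd hH (hX ω)
      (hQ.bddAbove_image (hX ω).continuousOn)
  obtain ⟨Z, hZm, hZG, hZt⟩ := hZ N
  have hac := map_add_covariance_absolutelyContinuous
    (W := fun (t : cube d N) ω ↦ G t ω - ∫ ω', G t ω' ∂P) (fun t ↦ hWm t) hZm hZG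
  have hadd : ∀ t : cube d N, cov[fun ω ↦ G t ω - ∫ ω', G t ω' ∂P, Z; P] = ∫ ω, G t ω ∂P :=
    fun t ↦ by rw [covariance_sub_const_left (hi t), hZt t t.2]
  simp only [hadd, sub_add_cancel] at hac
  have hGm' : Measurable fun ω (t : cube d N) ↦ G t ω := measurable_pi_lambda _ fun t ↦ hm t
  have hWm' : Measurable fun ω (t : cube d N) ↦ G t ω - ∫ ω', G t ω' ∂P :=
    measurable_pi_lambda _ fun t ↦ hWm t
  rw [hpre G hc, ← Measure.map_apply hGm' hDm]
  refine hac ?_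
  rw [Measure.map_apply hWm' hDm]
  rw [hpre W hWc] at hW0
  exact hW0

/-! ### Hyperplanes, measurability and the distribution function -/

theorem iUnion_cube (d : ℕ) : ⋃ N, cube d N = Set.univ :=
  Set.eq_univ_of_forall fun s ↦ by
    obtain ⟨N, hN⟩ := exists_cube_mem_nhds s
    exact Set.mem_iUnion.mpr ⟨N, mem_of_mem_nhds hN⟩

theorem measure_maximizer_in_hyperplane_eq_zero {d : ℕ} {G : (Fin d → ℝ) → Ω → ℝ}
    (hG : IsGaussianProcess G P) (hm : ∀ s, Measurable (G s)) (hc : ∀ ω, Continuous fun s ↦ G s ω)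
    (hpos : ∀ h : Fin d → ℝ, h ≠ 0 → 0 < cov[G h, G h; P])
    (hshift : ∀ s t h : Fin d → ℝ, h ≠ 0 →
      cov[G (h + s), G (h + t); P] - cov[G (h + s), G h; P] - cov[G h, G (h + t); P]
        + cov[G h, G h; P] = cov[G s, G t; P])
    (hZ : ∀ N, ∃ Z : Ω → ℝ, Measurable Z ∧ IsGaussianProcess
      (Sum.elim (fun (t : cube d N) ω ↦ G t ω - ∫ ω', G t ω' ∂P) fun _ : Unit ↦ Z) P ∧
      ∀ t ∈ cube d N, cov[G t, Z; P] = ∫ ω, G t ω ∂P) (i : Fin d) (c : ℝ) :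
    P {ω | ∃ s, IsMaximizer (fun t ↦ G t ω) s ∧ s i = c} = 0 := by
  have key : ∀ n : ℕ,
      P {ω | ∃ y ∈ cube d n ∩ {x | x i = c}, ∀ x ∈ cube d (n + 1), G x ω ≤ G y ω} = 0 := by
    intro n
    -- the translates by `1 / (k + 1)` in direction `i` move points by at most `1` relative to
    -- each other, so enlarging the cube from `n` to `n + 1` leaves enough room
    refine measure_max_in_subset_eq_zero_of_representers hG hm hc hpos hshift hZ
      (isCompact_Icc.inter_right (isClosed_eq (continuous_apply i) continuous_const))
      isCompact_Icc (fun k ↦ Pi.single i (1 / ((k : ℝ) + 1))) (fun k h ↦ ?_) ?_ ?_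
    · have h1 := congrFun h i
      rw [Pi.single_eq_same, Pi.zero_apply] at h1
      exact (Nat.one_div_pos_of_nat (α := ℝ) (n := k)).ne' h1
    · have hv : ∀ (k : ℕ) (j : Fin d), 0 ≤ (Pi.single i (1 / ((k : ℝ) + 1)) : Fin d → ℝ) j ∧
          (Pi.single i (1 / ((k : ℝ) + 1)) : Fin d → ℝ) j ≤ 1 := by
        intro k j
        have hk := Nat.one_div_le_one_div (α := ℝ) (Nat.zero_le k)
        rw [Nat.cast_zero, zero_add, div_one] at hk
        rw [Pi.single_apply]
        split_ifs
        · exact ⟨Nat.one_div_pos_of_nat.le, hk⟩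
        · simp
      rintro k l y ⟨hy, -⟩
      refine ⟨fun j ↦ ?_, fun j ↦ ?_⟩ <;> have hyj := hy.1 j <;> have hyj' := hy.2 j <;>
        simp only [Pi.add_apply, Pi.sub_apply, Nat.cast_add, Nat.cast_one] at hyj hyj' ⊢ <;>
        linarith [(hv k j).1, (hv k j).2, (hv l j).1, (hv l j).2]
    · rintro k l hkl y hy y' hy' h
      have h1 := congrFun h i
      have hyi : y i = c := hy.2
      have hyi' : y' i = c := hy'.2
      simp only [Pi.add_apply, Pi.single_eq_same, hyi, hyi'] at h1
      have h2 := add_right_cancel h1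
      rw [one_div, one_div, inv_inj, add_left_inj, Nat.cast_inj] at h2
      exact hkl h2
  refine measure_mono_null ?_ (measure_iUnion_null key)
  rintro ω ⟨s, hs, hsi⟩
  obtain ⟨n, hn⟩ := Set.mem_iUnion.mp ((iUnion_cube d).symm ▸ Set.mem_univ s)
  exact Set.mem_iUnion.mpr ⟨n, s, ⟨hn, hsi⟩, fun x _ ↦ hs x⟩

theorem nullMeasurableSet_maximizer_mem {E : Type*} [TopologicalSpace E]
    [SecondCountableTopology E] {G : E → Ω → ℝ} (hm : ∀ s, Measurable (G s))
    (hc : ∀ ω, Continuous fun s ↦ G s ω)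
    (hmax : ∀ᵐ ω ∂P, ∃ s, IsMaximizer (fun t ↦ G t ω) s) {C : Set E} (hC : IsCompact C) :
    NullMeasurableSet {ω | ∃ y ∈ C, IsMaximizer (fun t ↦ G t ω) y} P := by
  rcases C.eq_empty_or_nonempty with rfl | hne
  · simp
  obtain ⟨a, ha, had⟩ := exists_seq_dense_in (K := (Set.univ : Set E))
    (hne.mono (Set.subset_univ _))
  obtain ⟨b, hb, hbd⟩ := exists_seq_dense_in hne
  have h1 : MeasurableSet ((fun ω s ↦ G s ω) ⁻¹'
      {g : E → ℝ | ⨆ n, g (a n) ≤ ⨆ n, g (b n)}) :=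
    measurable_pi_lambda _ hm (measurableSet_iSup_le a b)
  refine h1.nullMeasurableSet.congr ?_
  filter_upwards [hmax] with ω ⟨s, hs⟩
  have h2 := exists_dominating_iff_iSup_le ha had hb hbd hC (hc ω)
    ⟨G s ω, by rintro _ ⟨x, -, rfl⟩; exact hs x⟩
  refine propext (h2.symm.trans ?_)
  simp only [Set.mem_univ, true_implies]
  rfl

theorem aemeasurable_maximizer {d : ℕ} {G : (Fin d → ℝ) → Ω → ℝ}
    (hm : ∀ s, Measurable (G s)) (hc : ∀ ω, Continuous fun s ↦ G s ω)
    (hun : ∀ᵐ ω ∂P, ∃! s, IsMaximizer (fun t ↦ G t ω) s) {s_hat : Ω → Fin d → ℝ}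
    (hs : ∀ᵐ ω ∂P, IsMaximizer (fun t ↦ G t ω) (s_hat ω)) : AEMeasurable s_hat P := by
  refine aemeasurable_pi_lambda _ fun i ↦ ?_
  suffices h : NullMeasurable (fun ω ↦ s_hat ω i) P from h.aemeasurable
  refine measurable_of_Iic (δ := NullMeasurableSpace Ω P) (f := fun ω ↦ s_hat ω i) fun c ↦ ?_
  have h1 : ∀ n, NullMeasurableSet
      {ω | ∃ y ∈ cube d n ∩ {x | x i ≤ c}, IsMaximizer (fun t ↦ G t ω) y} P := fun n ↦
    nullMeasurableSet_maximizer_mem hm hc (hun.mono fun ω h ↦ h.exists)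
      (isCompact_Icc.inter_right (isClosed_le (continuous_apply i) continuous_const))
  refine NullMeasurableSet.congr (NullMeasurableSet.iUnion h1) ?_
  filter_upwards [hun, hs] with ω hω hsω
  refine propext ⟨fun h ↦ ?_, fun h ↦ ?_⟩
  · obtain ⟨n, y, ⟨-, hy⟩, hymax⟩ := Set.mem_iUnion.mp h
    change s_hat ω i ≤ c
    rw [hω.unique hsω hymax]
    exact hy
  · obtain ⟨n, hn⟩ := Set.mem_iUnion.mp ((iUnion_cube d).symm ▸ Set.mem_univ (s_hat ω))
    exact Set.mem_iUnion.mpr ⟨n, s_hat ω, ⟨hn, h⟩, hsω⟩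

/-- A random vector whose coordinates have no atoms has a continuous distribution function. -/
theorem continuous_cdf_of_forall_measure_coord_eq_zero [IsFiniteMeasure P] {d : ℕ}
    {Y : Ω → Fin d → ℝ} (hY : AEMeasurable Y P) (h : ∀ i c, P {ω | Y ω i = c} = 0) :
    Continuous fun t : Fin d → ℝ ↦ P.real {ω | Y ω ≤ t} := by
  have hms : ∀ t, NullMeasurableSet {ω | Y ω ≤ t} P := fun t ↦
    hY.nullMeasurableSet_preimage measurableSet_Iic
  have hint : ∀ t, P.real {ω | Y ω ≤ t} = ∫ ω, {ω | Y ω ≤ t}.indicator 1 ω ∂P := fun t ↦ by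
    rw [integral_indicator₀ (hms t)]
    simp
  simp only [hint]
  refine continuous_iff_continuousAt.mpr fun t ↦ continuousAt_of_dominated (bound := fun _ ↦ 1)
    (.of_forall fun s ↦ ?_) (.of_forall fun s ↦ ae_of_all _ fun ω ↦ ?_) (integrable_const _) ?_
  · exact aestronglyMeasurable_one.indicator₀ (hms s)
  · by_cases hω : ω ∈ {ω | Y ω ≤ s} <;> simp [hω]
  · have hne : ∀ᵐ ω ∂P, ∀ i, Y ω i ≠ t i :=
      ae_all_iff.mpr fun i ↦ measure_eq_zero_iff_ae_notMem.mp (h i (t i))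
    filter_upwards [hne] with ω hω
    by_cases hle : Y ω ≤ t
    · have : ∀ᶠ s in 𝓝 t, Y ω ≤ s := by
        have h1 : ∀ i, ∀ᶠ s : Fin d → ℝ in 𝓝 t, Y ω i < s i := fun i ↦
          (continuous_apply i).continuousAt.eventually_const_lt (lt_of_le_of_ne (hle i) (hω i))
        filter_upwards [eventually_all.mpr h1] with s hs i using (hs i).le
      refine (continuousAt_const (y := (1 : ℝ))).congr ?_
      filter_upwards [this] with s hs
      simp [hs]
    · obtain ⟨i, hi⟩ := not_forall.mp hle
      have : ∀ᶠ s in 𝓝 t, ¬ Y ω ≤ s := by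
        filter_upwards [(continuous_apply i).continuousAt.eventually_lt_const (not_le.mp hi)]
          with s hs hle' using (hle' i).not_gt hs
      refine (continuousAt_const (y := (0 : ℝ))).congr ?_
      filter_upwards [this] with s hs
      simp [hs]

theorem covariance_congr_ae {X X' Y Y' : Ω → ℝ} (hX : X =ᵐ[P] X') (hY : Y =ᵐ[P] Y') :
    cov[X, Y; P] = cov[X', Y'; P] := by
  rw [covariance, covariance, integral_congr_ae hX, integral_congr_ae hY]
  refine integral_congr_ae ?_
  filter_upwards [hX, hY] with ω h1 h2
  rw [h1, h2]

end GaussianArgmax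

open GaussianArgmax in
theorem theorem1 {Ω : Type*} [MeasurableSpace Ω] (P : Measure Ω) [IsProbabilityMeasure P]
    (d : ℕ) (G : (Fin d → ℝ) → Ω → ℝ) (hG : IsGaussianProcess G P)
    (h_cont : ∀ᵐ ω ∂P, Continuous fun s ↦ G s ω)
    (h_max : ∀ᵐ ω ∂P, ∃ s, GaussianArgmax.IsMaximizer (fun t ↦ G t ω) s)
    (h_pos : ∀ h : Fin d → ℝ, h ≠ 0 → 0 < GaussianArgmax.covKernel G P h h)
    (h_shift : ∀ s t h : Fin d → ℝ, h ≠ 0 →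
      GaussianArgmax.covKernel G P (h + s) (h + t) - GaussianArgmax.covKernel G P (h + s) h
        - GaussianArgmax.covKernel G P h (h + t) + GaussianArgmax.covKernel G P h h
        = GaussianArgmax.covKernel G P s t)
    (h_rkhs : ∀ N : ℕ,
      GaussianArgmax.meanFun (fun (s : GaussianArgmax.cube d N) ↦ G s) P ∈
        GaussianArgmax.covRKHS (hG.restrict (GaussianArgmax.cube d N))) :
    (∀ᵐ ω ∂P, ∃! s, GaussianArgmax.IsMaximizer (fun t ↦ G t ω) s) ∧
    ∀ s_hat : Ω → (Fin d → ℝ),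
      (∀ᵐ ω ∂P, GaussianArgmax.IsMaximizer (fun t ↦ G t ω) (s_hat ω)) →
      AEMeasurable s_hat P ∧
      Continuous fun t : Fin d → ℝ ↦ P.real {ω | s_hat ω ≤ t} := by
  obtain ⟨Y, hYm, hYc, hGY⟩ := exists_continuous_modification hG.aemeasurable h_cont
  have hGY' : ∀ t, G t =ᵐ[P] Y t := fun t ↦ hGY.mono fun ω h ↦ h t
  have hY : IsGaussianProcess Y P := hG.congr hGY'
  have hmean : ∀ t, ∫ ω, G t ω ∂P = ∫ ω, Y t ω ∂P := fun t ↦ integral_congr_ae (hGY' t)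
  have hcov : ∀ s t, covKernel G P s t = cov[Y s, Y t; P] := fun s t ↦
    covariance_congr_ae (hGY' s) (hGY' t)
  simp only [hcov] at h_pos h_shift
  have hmaxY : ∀ᵐ ω ∂P, ∀ s, IsMaximizer (fun t ↦ G t ω) s ↔ IsMaximizer (fun t ↦ Y t ω) s := by
    filter_upwards [hGY] with ω h s
    simp only [IsMaximizer, h]
  have hZ : ∀ N, ∃ Z : Ω → ℝ, Measurable Z ∧ IsGaussianProcess
      (Sum.elim (fun (t : cube d N) ω ↦ Y t ω - ∫ ω', Y t ω' ∂P) fun _ : Unit ↦ Z) P ∧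
      ∀ t ∈ cube d N, cov[Y t, Z; P] = ∫ ω, Y t ω ∂P := by
    intro N
    obtain ⟨Z, hZm, hZG, hZt⟩ := exists_of_mem_covRKHS _ (h_rkhs N)
    refine ⟨Z, hZm, hZG.congr ?_, fun t ht ↦ ?_⟩
    · rintro (t | _)
      · filter_upwards [hGY' t] with ω hω
        simp only [Sum.elim_inl, hω, hmean]
      · rfl
    · have h1 := hZt ⟨t, ht⟩
      rw [covariance_sub_const_left (hG.hasGaussianLaw_eval t).integrable,
        covariance_congr_ae (hGY' t) Filter.EventuallyEq.rfl] at h1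
      rw [h1, ← hmean]
      rfl
  have hun := ae_maximizer_unique hY hYm hYc
    (variance_sub_ne_zero hY h_pos h_shift) Set.univ
  have hex : ∀ᵐ ω ∂P, ∃! s, IsMaximizer (fun t ↦ Y t ω) s := by
    filter_upwards [h_max, hmaxY, hun] with ω ⟨s, hs⟩ hiff hu
    exact ⟨s, (hiff s).mp hs, fun t ht ↦ hu t trivial s trivial (fun z _ ↦ ht z)
      fun z _ ↦ (hiff s).mp hs z⟩
  refine ⟨?_, fun s_hat hs ↦ ?_⟩
  · filter_upwards [hex, hmaxY] with ω h hiff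
    simpa only [hiff] using h
  have hsY : ∀ᵐ ω ∂P, IsMaximizer (fun t ↦ Y t ω) (s_hat ω) := by
    filter_upwards [hs, hmaxY] with ω h hiff using (hiff _).mp h
  have hae := aemeasurable_maximizer hYm hYc hex hsY
  refine ⟨hae, continuous_cdf_of_forall_measure_coord_eq_zero hae fun i c ↦ ?_⟩
  refine measure_mono_null_ae ?_
    (measure_maximizer_in_hyperplane_eq_zero hY hYm hYc h_pos h_shift hZ i c)
  filter_upwards [hsY] with ω h hi using ⟨s_hat ω, h, hi⟩
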